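/- Let $X$ be a finite set, let $Y$ be a finite abelian group with $M=|Y|$ elements, and let $k\ge 1$ and $q\ge 0$ be integers. A $k$-parallel query to a function $H:X\to Y$ is the unitary $O_H^k:|\mathbf x\rangle|\mathbf y\rangle|w\rangle\mapsto|\mathbf x\rangle|\mathbf y+H(\mathbf x)\rangle|w\rangle$ on $\mathbb C[X]^{\otimes k}\otimes\mathbb C[Y]^{\otimes k}\otimes\mathbb C^d$, where $\mathbf x\in X^k$, $\mathbf y\in Y^k$ and $H(\mathbf x)=(H(x_1),\dots,H(x_k))$. A $k$-parallel $q$-query quantum algorithm (with arbitrary finite workspace dimension $d$) starts in a unit vector $|\psi_0\rangle$, is brought into the state $U_q\,O_H^k\,U_{q-1}\,O_H^k\cdots U_1\,O_H^k|\psi_0\rangle$ with arbitrary unitaries $U_1,\dots,U_q$ that do not depend on $H$, and measures all its registers in the computational basis; its output is a pair $(x,x')\in X\times X$ that is a function of the measurement outcome. Let $p$ be the probability, over a uniformly random function $H:X\to Y$ and the measurement, that the output is a collision, i.e. $x\neq x'$ and $H(x)=H(x')$. **Theorem.** (1) For every $k$-parallel $q$-query quantum algorithm, $$p\;\le\;\left(2(q+1)\,e\,k\,\sqrt{10\,\frac{q+1}{M}}+\sqrt{\frac{2}{M}}\right)^{2}.$$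 (2) The right-hand side is $O(k^2q^3/M)$: there is a universal constant $C>0$ such that it is at most $C\,k^2q^3/M$ for all integers $k,q,M\ge 1$. (3) Consequently, for every $\delta>0$ there is a constant $c>0$, depending only on $\delta$, such that every $k$-parallel $q$-query algorithm with $q\ge 1$ that outputs a collision with probability $p\ge\delta$ satisfies $q\ge c\,(M/k^2)^{1/3}$. -/

import Mathlib

/-- Computational-basis labels of the registers of a `k`-parallel query algorithm: `k` query
inputs, `k` query responses and a `d`-dimensional workspace, i.e. the basis labels of
`ℂ[X]^{⊗k} ⊗ ℂ[Y]^{⊗k} ⊗ ℂ^d`. -/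
abbrev QReg (X Y : Type*) (k d : ℕ) : Type _ :=
  (Fin k → X) × (Fin k → Y) × Fin d

/-- The permutation `(x, y, w) ↦ (x, y + H(x), w)` of the basis labels, where
`H(x) = (H(x₁), …, H(x_k))`. -/
def queryPerm {X Y : Type*} [AddCommGroup Y] {k d : ℕ} (H : X → Y) :
    Equiv.Perm (QReg X Y k d) where
  toFun r := (r.1, r.2.1 + H ∘ r.1, r.2.2)
  invFun r := (r.1, r.2.1 - H ∘ r.1, r.2.2)
  left_inv r := by simp
  right_inv r := by simp

/-- One `k`-parallel query to the function `H`: the unitary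
`|x⟩|y⟩|w⟩ ↦ |x⟩|y + H(x)⟩|w⟩`. -/
noncomputable def parallelQuery {X Y : Type*} [Fintype X] [Fintype Y] [AddCommGroup Y]
    {k d : ℕ} (H : X → Y) :
    EuclideanSpace ℂ (QReg X Y k d) ≃ₗᵢ[ℂ] EuclideanSpace ℂ (QReg X Y k d) :=
  LinearIsometryEquiv.piLpCongrLeft 2 ℂ ℂ (queryPerm H)

theorem parallelQuery_single {X Y : Type*} [Fintype X] [Fintype Y] [AddCommGroup Y]
    [DecidableEq X] [DecidableEq Y] {k d : ℕ} (H : X → Y)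
    (x : Fin k → X) (y : Fin k → Y) (w : Fin d) :
    parallelQuery H (EuclideanSpace.single (x, y, w) (1 : ℂ)) =
      EuclideanSpace.single (x, y + H ∘ x, w) (1 : ℂ) :=
  LinearIsometryEquiv.piLpCongrLeft_single (queryPerm H) (x, y, w) (1 : ℂ)

/-- A `k`-parallel `q`-query quantum oracle algorithm with a pair of inputs as its output:
it starts in a normalized state, makes `q` rounds of `k` parallel queries, applies an arbitrary
unitary of its own after each round, finally measures all its registers in the computational
basis and outputs a pair that it reads off from the measurement outcome. The workspace
dimension is arbitrary. -/
structure ParallelQueryAlg (X Y : Type*) [Fintype X] [Fintype Y] (k q : ℕ) where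
  dim : ℕ
  init : EuclideanSpace ℂ (QReg X Y k dim)
  norm_init : ‖init‖ = 1
  unitary : Fin q →
    (EuclideanSpace ℂ (QReg X Y k dim) ≃ₗᵢ[ℂ] EuclideanSpace ℂ (QReg X Y k dim))
  output : QReg X Y k dim → X × X

/-- The state `U_q O^k U_{q-1} O^k ⋯ U_1 O^k |init⟩` before the final measurement, when the
oracle is the function `H`. -/
noncomputable def ParallelQueryAlg.finalState {X Y : Type*} [Fintype X] [Fintype Y]
    [AddCommGroup Y] {k q : ℕ} (A : ParallelQueryAlg X Y k q) (H : X → Y) :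
    EuclideanSpace ℂ (QReg X Y k A.dim) :=
  Fin.foldl q (fun ψ s => A.unitary s (parallelQuery H ψ)) A.init

/-- The pair `p` is a collision of `H`. -/
abbrev IsCollision {X Y : Type*} (H : X → Y) (p : X × X) : Prop :=
  p.1 ≠ p.2 ∧ H p.1 = H p.2

/-- The probability that `A` outputs a collision of `H` when its oracle is `H`. -/
noncomputable def ParallelQueryAlg.collisionProbFor {X Y : Type*} [Fintype X] [Fintype Y]
    [DecidableEq X] [DecidableEq Y] [AddCommGroup Y] {k q : ℕ}
    (A : ParallelQueryAlg X Y k q) (H : X → Y) : ℝ :=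
  ∑ r : QReg X Y k A.dim, if IsCollision H (A.output r) then ‖A.finalState H r‖ ^ 2 else 0

/-- The probability that `A` outputs a collision of the random oracle, i.e. when its oracle is
a uniformly random function `H : X → Y`. -/
noncomputable def ParallelQueryAlg.collisionProb {X Y : Type*} [Fintype X] [Fintype Y]
    [DecidableEq X] [DecidableEq Y] [AddCommGroup Y] {k q : ℕ}
    (A : ParallelQueryAlg X Y k q) : ℝ :=
  (∑ H : X → Y, A.collisionProbFor H) / (Fintype.card (X → Y) : ℝ)

/-- The explicit bound
`(2(q+1)ek√(10(q+1)/M) + √(2/M))²`. -/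
noncomputable def collisionBound (k q M : ℕ) : ℝ :=
  (2 * ((q : ℝ) + 1) * Real.exp 1 * (k : ℝ) * √(10 * (((q : ℝ) + 1) / (M : ℝ)))
    + √(2 / (M : ℝ))) ^ 2

/-!
The proof is Zhandry's compressed oracle technique, in the form that accounts for parallel queries.

Run the algorithm jointly with a register that holds the oracle `H : X → Y`, prepared in the uniform
superposition. Each factor `ℂ[Y]` of this register sits in `ℂ[Y ∪ {⊥}]`, and the reflection
`compMat Y` exchanges `|⊥⟩` with the uniform superposition of `Y`. After this reflection has been
applied to every factor (`compress`) the basis states of the register are the partial functions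
`D : X → Option Y`. At the beginning `D` is nowhere defined (`compress_const_eq_zero`), a query in
`k` points enlarges its domain by at most `k` points (`SizeLE.parallelQuery`), and the unitaries of
the algorithm act on another tensor factor. The progress measure is the square root of
`collWeight`, the norm of the part of the joint state in which `D` is not injective on its domain.

In the Fourier basis of the response registers a query with inputs `x₁, …, x_k` multiplies the
joint state by a product of phases, each of which depends on the value of `H` at one of the points
(`fourierY_parallelQuery`). In compressed form this is a tensor product of contractions
`compMat * diagonal * compMat`, one for every queried point. Their rows indexed by values have
off-diagonal square sum at most `8 / M` (`rowBound_conj_compMat`): such a factor can write a given value over something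
else only with squared amplitude `8 / M`. A collision that was not there before involves
a queried point and either one of the at most `k s` points in the domain after `s` rounds or another
queried point. A union bound over these pairs, for squared amplitudes, bounds the
growth of the progress measure by `√(8 k (4 k + k s) / M)` (`sum_hasCollision_prodOp_le`). Taking
the union bound inside a round and the triangle inequality only between the rounds gives the
dependence `k² q³ / M` rather than `k³ q³ / M`.

Finally, undoing the compression is again a tensor product of contractions with small off-diagonal
rows, so a collision of `H` at the output pair has amplitude at most that of a collision of `D`
plus `2 √(2 / M)` (`sqrt_collision_le`). The sum of these contributions is below the stated
bound, and the remaining claims are elementary consequences of it.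
-/

open Function Finset

set_option linter.unusedSectionVars false

/-! ### Operators on tensor factors -/

section LocalOperators

variable {X Z : Type*} [Fintype X] [DecidableEq X] [Fintype Z] [DecidableEq Z]

/-- Sums over functions can be compared along the lines in the direction of one coordinate. -/
theorem sum_le_sum_of_update_le (x : X) (φ ψ : (X → Z) → ℝ)
    (h : ∀ D, ∑ d, φ (update D x d) ≤ ∑ d, ψ (update D x d)) :
    ∑ D, φ D ≤ ∑ D, ψ D := by
  have key : ∀ θ : (X → Z) → ℝ, ∑ D, θ D = ∑ b : {j // j ≠ x} → Z, ∑ d : Z,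
      θ ((Equiv.funSplitAt x Z).symm (d, b)) := by
    intro θ
    rw [← (Equiv.funSplitAt x Z).symm.sum_comp, Fintype.sum_prod_type_right]
  rw [key, key]
  refine Finset.sum_le_sum fun b _ => ?_
  rcases isEmpty_or_nonempty Z with hZ | ⟨⟨z⟩⟩
  · simp
  · have hu : ∀ d : Z, (Equiv.funSplitAt x Z).symm (d, b)
        = update ((Equiv.funSplitAt x Z).symm (z, b)) x d := by
      intro d
      ext j
      by_cases hj : j = x <;> simp [Equiv.funSplitAt, Equiv.piSplitAt, update, hj]
    simpa only [← hu] using h ((Equiv.funSplitAt x Z).symm (z, b))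

/-- The operator on functions of `D : X → Z` that applies the matrix `K` to the coordinate
`D x`, i.e. `K` acting on the `x`-th tensor factor of `ℂ[Z]^{⊗ X}`. -/
def localOp (x : X) (K : Matrix Z Z ℂ) : Module.End ℂ ((X → Z) → ℂ) where
  toFun F D := ∑ d, K (D x) d * F (update D x d)
  map_add' F G := by ext D; simp [mul_add, sum_add_distrib]
  map_smul' c F := by ext D; simp [mul_sum, mul_left_comm]

theorem localOp_apply (x : X) (K : Matrix Z Z ℂ) (F : (X → Z) → ℂ) (D : X → Z) :
    localOp x K F D = ∑ d, K (D x) d * F (update D x d) := rfl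

theorem localOp_commute {x x' : X} (h : x ≠ x') (K L : Matrix Z Z ℂ) :
    Commute (localOp x K) (localOp x' L) := by
  refine LinearMap.ext fun F => funext fun D => ?_
  simp only [Module.End.mul_apply, localOp_apply, mul_sum, update_of_ne h, update_of_ne h.symm]
  rw [sum_comm]
  refine sum_congr rfl fun a _ => sum_congr rfl fun b _ => ?_
  rw [update_comm h]
  ring

theorem localOp_mul (x : X) (K L : Matrix Z Z ℂ) :
    localOp x (K * L) = localOp x K * localOp x L := by
  refine LinearMap.ext fun F => funext fun D => ?_
  simp only [Module.End.mul_apply, localOp_apply, mul_sum, update_self, update_idem,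
    Matrix.mul_apply, sum_mul]
  rw [sum_comm]
  simp only [mul_assoc]

theorem localOp_diagonal (x : X) (g : Z → ℂ) (F : (X → Z) → ℂ) (D : X → Z) :
    localOp x (Matrix.diagonal g) F D = g (D x) * F D := by
  rw [localOp_apply, sum_eq_single (D x)]
  · simp
  · intro b _ hb
    simp [Matrix.diagonal_apply_ne' _ hb]
  · simp

theorem localOp_one (x : X) : localOp x (1 : Matrix Z Z ℂ) = 1 := by
  refine LinearMap.ext fun F => funext fun D => ?_
  rw [← Matrix.diagonal_one, localOp_diagonal]
  simp

/-- The matrix `K` is a contraction for the Euclidean norm. -/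
def IsContr (K : Matrix Z Z ℂ) : Prop :=
  ∀ v : Z → ℂ, ∑ d, ‖(K.mulVec v) d‖ ^ 2 ≤ ∑ d, ‖v d‖ ^ 2

theorem IsContr.mul {K L : Matrix Z Z ℂ} (hK : IsContr K) (hL : IsContr L) :
    IsContr (K * L) := by
  intro v
  rw [← Matrix.mulVec_mulVec]
  exact (hK _).trans (hL _)

theorem isContr_diagonal {g : Z → ℂ} (hg : ∀ d, ‖g d‖ = 1) : IsContr (Matrix.diagonal g) := by
  intro v
  simp [Matrix.mulVec_diagonal, hg]

theorem IsContr.norm_apply_le_one {K : Matrix Z Z ℂ} (hK : IsContr K) (d e : Z) :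
    ‖K d e‖ ≤ 1 := by
  have h := hK (Pi.single e 1)
  have h1 : ∑ d, ‖(Pi.single e 1 : Z → ℂ) d‖ ^ 2 = 1 := by
    rw [sum_eq_single e]
    · simp
    · intro b _ hb; simp [hb]
    · simp
  rw [h1] at h
  have h2 := (single_le_sum (f := fun d => ‖(K.mulVec (Pi.single e 1)) d‖ ^ 2)
    (fun i _ => by positivity) (mem_univ d)).trans h
  simp only [Matrix.mulVec_single_one, Matrix.col_apply] at h2
  nlinarith [norm_nonneg (K d e)]

theorem localOp_contr (x : X) {K : Matrix Z Z ℂ} (hK : IsContr K) (F : (X → Z) → ℂ) :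
    ∑ D, ‖localOp x K F D‖ ^ 2 ≤ ∑ D, ‖F D‖ ^ 2 := by
  refine sum_le_sum_of_update_le x _ _ fun D => ?_
  simpa [localOp_apply, Matrix.mulVec, dotProduct] using hK fun d => F (update D x d)

/-- The matrices `K x`, `x ∈ S`, acting on their own tensor factors. -/
noncomputable def prodOp (S : Finset X) (K : X → Matrix Z Z ℂ) : Module.End ℂ ((X → Z) → ℂ) :=
  S.noncommProd (fun x => localOp x (K x)) fun _ _ _ _ h => localOp_commute h _ _

theorem mul_prodOp_erase {S : Finset X} {x : X} (hx : x ∈ S) (K : X → Matrix Z Z ℂ) :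
    localOp x (K x) * prodOp (S.erase x) K = prodOp S K :=
  S.mul_noncommProd_erase hx (fun x => localOp x (K x)) fun _ _ _ _ h => localOp_commute h _ _

theorem prodOp_insert {S : Finset X} {x : X} (hx : x ∉ S) (K : X → Matrix Z Z ℂ) :
    prodOp (insert x S) K = localOp x (K x) * prodOp S K :=
  noncommProd_insert_of_notMem _ _ _ _ hx

theorem prodOp_empty (K : X → Matrix Z Z ℂ) : prodOp ∅ K = 1 := noncommProd_empty _ _

theorem localOp_commute_prodOp {S : Finset X} {x : X} (hx : x ∉ S) (L : Matrix Z Z ℂ)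
    (K : X → Matrix Z Z ℂ) : Commute (localOp x L) (prodOp S K) :=
  noncommProd_commute _ _ _ _ fun _ hy => localOp_commute (ne_of_mem_of_not_mem hy hx).symm _ _

theorem prodOp_contr (S : Finset X) {K : X → Matrix Z Z ℂ} (hK : ∀ x, IsContr (K x))
    (F : (X → Z) → ℂ) : ∑ D, ‖prodOp S K F D‖ ^ 2 ≤ ∑ D, ‖F D‖ ^ 2 := by
  induction S using Finset.induction_on with
  | empty => simp [prodOp_empty]
  | insert x S hx ih =>
    rw [prodOp_insert hx]
    exact (localOp_contr x (hK x) _).trans ih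

/-- Operators on the factors in `S` preserve vanishing on a set that is stable under changes of
the coordinates in `S`. -/
theorem prodOp_eq_zero_of_forall_update {S : Finset X} (K : X → Matrix Z Z ℂ)
    {P : (X → Z) → Prop} (hP : ∀ x ∈ S, ∀ D d, P D → P (update D x d)) {F : (X → Z) → ℂ}
    (hF : ∀ D, P D → F D = 0) : ∀ D, P D → prodOp S K F D = 0 := by
  induction S using Finset.induction_on with
  | empty => simpa [prodOp_empty] using hF
  | insert x S hx ih =>
    intro D hD
    rw [prodOp_insert hx, Module.End.mul_apply, localOp_apply]
    refine sum_eq_zero fun d _ => ?_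
    rw [ih (fun y hy => hP y (mem_insert_of_mem hy)) _ (hP x (mem_insert_self _ _) D d hD),
      mul_zero]

theorem prodOp_diagonal (S : Finset X) (g : X → Z → ℂ) (F : (X → Z) → ℂ) (D : X → Z) :
    prodOp S (fun x => Matrix.diagonal (g x)) F D = (∏ x ∈ S, g x (D x)) * F D := by
  induction S using Finset.induction_on with
  | empty => simp [prodOp_empty]
  | insert x S hx ih =>
    rw [prodOp_insert hx, Module.End.mul_apply, localOp_diagonal, ih, prod_insert hx, mul_assoc]

theorem prodOp_mul_self {K : X → Matrix Z Z ℂ} (hK : ∀ x, K x * K x = 1) (S : Finset X) :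
    prodOp S K * prodOp S K = 1 := by
  induction S using Finset.induction_on with
  | empty => simp [prodOp_empty]
  | insert x S hx ih =>
    have hc := (localOp_commute_prodOp hx (K x) K).eq
    rw [prodOp_insert hx, mul_assoc, ← mul_assoc (prodOp S K), ← hc, mul_assoc, ih, mul_one,
      ← localOp_mul, hK, localOp_one]

/-- Conjugating the factors in `S` by an involution `W` moves an operator through `W^{⊗ X}`. -/
theorem prodOp_univ_mul_prodOp {W : Matrix Z Z ℂ} (hW : W * W = 1) (S : Finset X)
    (K : X → Matrix Z Z ℂ) :
    prodOp univ (fun _ => W) * prodOp S K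
      = prodOp S (fun x => W * K x * W) * prodOp univ (fun _ => W) := by
  induction S using Finset.induction_on with
  | empty => simp [prodOp_empty]
  | insert x S hx ih =>
    have h1 : prodOp univ (fun _ => W) * localOp x (K x)
        = localOp x (W * K x * W) * prodOp univ (fun _ => W) := by
      rw [← mul_prodOp_erase (mem_univ x) (fun _ => W), mul_assoc,
        ← (localOp_commute_prodOp (notMem_erase x univ) (K x) _).eq, ← mul_assoc, ← mul_assoc,
        ← localOp_mul, ← localOp_mul, mul_assoc (W * K x), hW, mul_one]
    rw [prodOp_insert hx, prodOp_insert hx, ← mul_assoc, h1, mul_assoc, ih, ← mul_assoc]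

end LocalOperators

/-! ### Quadratic sums -/

theorem norm_sum_mul_sq_le {ι : Type*} (s : Finset ι) (a b : ι → ℂ) :
    ‖∑ i ∈ s, a i * b i‖ ^ 2 ≤ (∑ i ∈ s, ‖a i‖ ^ 2) * ∑ i ∈ s, ‖b i‖ ^ 2 := by
  refine le_trans ?_ (sum_mul_sq_le_sq_mul_sq s (fun i => ‖a i‖) fun i => ‖b i‖)
  gcongr
  refine (norm_sum_le _ _).trans (le_of_eq ?_)
  simp

theorem sqrt_sum_add_sq_le {ι : Type*} (s : Finset ι) (a b : ι → ℝ) :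
    √(∑ i ∈ s, (a i + b i) ^ 2) ≤ √(∑ i ∈ s, a i ^ 2) + √(∑ i ∈ s, b i ^ 2) := by
  refine Real.sqrt_le_iff.2 ⟨by positivity, ?_⟩
  have h := Real.sum_mul_le_sqrt_mul_sqrt s a b
  have ha : 0 ≤ ∑ i ∈ s, a i ^ 2 := sum_nonneg fun _ _ => sq_nonneg _
  have hb : 0 ≤ ∑ i ∈ s, b i ^ 2 := sum_nonneg fun _ _ => sq_nonneg _
  rw [add_sq, Real.sq_sqrt ha, Real.sq_sqrt hb]
  simp only [add_sq, sum_add_distrib, mul_assoc, ← mul_sum]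
  linarith

theorem sqrt_sum_norm_add_sq_le {ι : Type*} (s : Finset ι) (F G : ι → ℂ) :
    √(∑ i ∈ s, ‖F i + G i‖ ^ 2) ≤ √(∑ i ∈ s, ‖F i‖ ^ 2) + √(∑ i ∈ s, ‖G i‖ ^ 2) := by
  refine le_trans (Real.sqrt_le_sqrt (sum_le_sum fun i _ => ?_))
    (sqrt_sum_add_sq_le s (fun i => ‖F i‖) fun i => ‖G i‖)
  gcongr
  exact norm_add_le _ _

theorem norm_add_sq_le_two_mul (a b : ℂ) : ‖a + b‖ ^ 2 ≤ 2 * (‖a‖ ^ 2 + ‖b‖ ^ 2) := by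
  have h := norm_add_le a b
  nlinarith [norm_nonneg (a + b), sq_nonneg (‖a‖ - ‖b‖), norm_nonneg a, norm_nonneg b]

/-- Minkowski's inequality for a pointwise bound `a ≤ b + c t` between square roots. -/
theorem sqrt_sum_le_of_sqrt_le {ι : Type*} (s : Finset ι) {a b t : ι → ℝ} {c : ℝ} (hc : 0 ≤ c)
    (ha : ∀ i, 0 ≤ a i) (hb : ∀ i, 0 ≤ b i) (ht : ∀ i, 0 ≤ t i)
    (h : ∀ i ∈ s, √(a i) ≤ √(b i) + c * √(t i)) :
    √(∑ i ∈ s, a i) ≤ √(∑ i ∈ s, b i) + c * √(∑ i ∈ s, t i) := by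
  have h1 : √(∑ i ∈ s, a i) ≤ √(∑ i ∈ s, (√(b i) + c * √(t i)) ^ 2) := by
    refine Real.sqrt_le_sqrt (sum_le_sum fun i hi => ?_)
    rw [← Real.sq_sqrt (ha i)]
    gcongr
    exact h i hi
  refine (h1.trans (sqrt_sum_add_sq_le s (fun i => √(b i)) fun i => c * √(t i))).trans ?_
  simp only [mul_pow, Real.sq_sqrt (hb _), Real.sq_sqrt (ht _), ← mul_sum]
  rw [Real.sqrt_mul (sq_nonneg c), Real.sqrt_sq hc]

/-! ### Collisions in a partial function -/

section Collisions

variable {X Y : Type*} [Fintype X] [DecidableEq X] [Fintype Y] [DecidableEq Y]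

/-- The partial function `D` is defined at `x` and `x'`, with the same value. -/
abbrev SameValue (x x' : X) (D : X → Option Y) : Prop := D x = D x' ∧ D x' ≠ none

/-- The partial function `D` is not injective on its domain. -/
abbrev HasCollision (D : X → Option Y) : Prop := ∃ x x', x ≠ x' ∧ SameValue x x' D

/-- The domain of the partial function `D`. -/
def pdom (D : X → Option Y) : Finset X := univ.filter fun x => D x ≠ none

theorem mem_pdom {D : X → Option Y} {x : X} : x ∈ pdom D ↔ D x ≠ none := by simp [pdom]

theorem sameValue_update_left_iff {x x' : X} (hx : x ≠ x') (D : X → Option Y) (d : Option Y) :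
    SameValue x x' (update D x d) ↔ d = D x' ∧ D x' ≠ none := by
  simp [SameValue, update_of_ne hx.symm]

/-- In each row indexed by a value `y`, the off-diagonal entries of `K` have square sum at most
`ρ`: this is the amplitude with which `K` can write `y` over something else. -/
def RowBound (K : Matrix (Option Y) (Option Y) ℂ) (ρ : ℝ) : Prop :=
  ∀ y : Y, ∑ d ∈ univ.erase (some y), ‖K (some y) d‖ ^ 2 ≤ ρ

/-- Only the value of `D x'` can be written at `x` to create a collision between `x` and `x'`. -/
theorem sum_sameValue_offDiag_le {x x' : X} (hx : x ≠ x') {K : Matrix (Option Y) (Option Y) ℂ}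
    {ρ : ℝ} (hK : RowBound K ρ) (hρ : 0 ≤ ρ) (G : (X → Option Y) → ℂ) :
    ∑ D with SameValue x x' D, ‖∑ d ∈ univ.erase (D x), K (D x) d * G (update D x d)‖ ^ 2
      ≤ ρ * ∑ D with D x' ≠ none, ‖G D‖ ^ 2 := by
  rw [sum_filter, sum_filter, mul_sum]
  refine sum_le_sum_of_update_le x _ _ fun D => ?_
  simp only [sameValue_update_left_iff hx, update_self, update_of_ne hx.symm, update_idem]
  cases hD : D x' with
  | none => simp
  | some y =>
    rw [sum_eq_single (some y)]
    · simp only [ne_eq, reduceCtorEq, not_false_eq_true, and_self, if_true, ← mul_sum]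
      refine (norm_sum_mul_sq_le _ _ _).trans ?_
      refine mul_le_mul (hK y) ?_ (by positivity) hρ
      exact sum_le_sum_of_subset_of_nonneg (subset_univ _) fun _ _ _ => by positivity
    · intro d _ hd
      simp [hd]
    · simp

theorem localOp_eq_diag_add (x : X) (K : Matrix (Option Y) (Option Y) ℂ)
    (F : (X → Option Y) → ℂ) (D : X → Option Y) :
    localOp x K F D = K (D x) (D x) * F D
      + ∑ d ∈ univ.erase (D x), K (D x) d * F (update D x d) := by
  rw [localOp_apply, ← add_sum_erase _ _ (mem_univ (D x)), update_eq_self]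

theorem sum_sameValue_localOp_le {x x' : X} (hx : x ≠ x')
    {K : Matrix (Option Y) (Option Y) ℂ} {ρ : ℝ} (hK : RowBound K ρ) (hρ : 0 ≤ ρ)
    {G : (X → Option Y) → ℂ} (hG : ∀ D, SameValue x x' D → G D = 0) :
    ∑ D with SameValue x x' D, ‖localOp x K G D‖ ^ 2
      ≤ ρ * ∑ D with D x' ≠ none, ‖G D‖ ^ 2 := by
  refine le_trans (le_of_eq (sum_congr rfl fun D hD => ?_)) (sum_sameValue_offDiag_le hx hK hρ G)
  rw [localOp_eq_diag_add, hG D (mem_filter.1 hD).2, mul_zero, zero_add]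

theorem sameValue_comm {x x' : X} {D : X → Option Y} :
    SameValue x x' D ↔ SameValue x' x D := by
  constructor <;> rintro ⟨h1, h2⟩
  · exact ⟨h1.symm, h1 ▸ h2⟩
  · exact ⟨h1.symm, h1 ▸ h2⟩

theorem sameValue_update_iff {x x' z : X} (hz : z ≠ x) (hz' : z ≠ x') (D : X → Option Y)
    (d : Option Y) : SameValue x x' (update D z d) ↔ SameValue x x' D := by
  simp [SameValue, update_of_ne hz.symm, update_of_ne hz'.symm]

/-- The amplitude with which operators on the factors in `S` create a collision between two
points of `S`. -/
theorem sum_sameValue_prodOp_le_of_mem {S : Finset X} {x x' : X} (hxS : x ∈ S) (hxS' : x' ∈ S)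
    (hx : x ≠ x') {K : X → Matrix (Option Y) (Option Y) ℂ} {ρ : ℝ} (hK : ∀ x, RowBound (K x) ρ)
    (hc : ∀ x, IsContr (K x)) (hρ : 0 ≤ ρ)
    {φ : (X → Option Y) → ℂ} (hφ : ∀ D, SameValue x x' D → φ D = 0) :
    ∑ D with SameValue x x' D, ‖prodOp S K φ D‖ ^ 2 ≤ 4 * ρ * ∑ D, ‖φ D‖ ^ 2 := by
  -- The factors away from `x` and `x'` do not affect the event.
  set R := prodOp ((S.erase x).erase x') K φ with hR
  set G := localOp x' (K x') R with hG
  have hS : prodOp S K φ = localOp x (K x) G := by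
    rw [← mul_prodOp_erase hxS, ← mul_prodOp_erase (mem_erase.2 ⟨hx.symm, hxS'⟩)]
    rfl
  have hR0 : ∀ D, SameValue x x' D → R D = 0 := by
    refine prodOp_eq_zero_of_forall_update K (fun z hz D d hD => ?_) hφ
    simp only [mem_erase] at hz
    exact (sameValue_update_iff hz.2.1 hz.1 D d).2 hD
  have hR1 : ∑ D, ‖R D‖ ^ 2 ≤ ∑ D, ‖φ D‖ ^ 2 := prodOp_contr _ hc φ
  have hG1 : ∑ D, ‖G D‖ ^ 2 ≤ ∑ D, ‖φ D‖ ^ 2 := (localOp_contr x' (hc x') R).trans hR1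
  have sub : ∀ (P : (X → Option Y) → Prop) [DecidablePred P] (F : (X → Option Y) → ℂ),
      ∑ D with P D, ‖F D‖ ^ 2 ≤ ∑ D, ‖F D‖ ^ 2 := fun P _ F =>
    sum_le_sum_of_subset_of_nonneg (subset_univ _) fun _ _ _ => by positivity
  -- The diagonal entry at `x`: the common value was written at `x'`, and `x` kept it.
  have h1 : ∑ D with SameValue x x' D, ‖G D‖ ^ 2 ≤ ρ * ∑ D, ‖φ D‖ ^ 2 := by
    have h := sum_sameValue_localOp_le hx.symm (hK x') hρ
      (G := R) (fun D hD => hR0 D (sameValue_comm.1 hD))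
    simp only [sameValue_comm (x := x') (x' := x)] at h
    refine h.trans ?_
    gcongr
    exact (sub _ R).trans hR1
  -- The off-diagonal entries at `x`: the common value was written at `x`.
  have h2 := sum_sameValue_offDiag_le hx (hK x) hρ G
  have h2' : ρ * ∑ D with D x' ≠ none, ‖G D‖ ^ 2 ≤ ρ * ∑ D, ‖φ D‖ ^ 2 := by
    gcongr
    exact (sub _ G).trans hG1
  have h3 : ∀ D, ‖prodOp S K φ D‖ ^ 2 ≤ 2 * (‖G D‖ ^ 2
      + ‖∑ d ∈ univ.erase (D x), K x (D x) d * G (update D x d)‖ ^ 2) := by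
    intro D
    rw [hS, localOp_eq_diag_add]
    refine (norm_add_sq_le_two_mul _ _).trans ?_
    gcongr
    rw [norm_mul]
    exact mul_le_of_le_one_left (norm_nonneg _) ((hc x).norm_apply_le_one _ _)
  refine (sum_le_sum fun D _ => h3 D).trans ?_
  rw [← mul_sum, sum_add_distrib]
  linarith

/-- Operators on `k` factors turn a collision-free vector, supported on domains of at most `m`
points, into one whose collision part is small: there are at most `k * k` pairs of points for
collisions within the new values and `k * m` pairs for collisions with an old one. -/
theorem sum_hasCollision_prodOp_le {S : Finset X} {k m : ℕ} (hS : S.card ≤ k)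
    {K : X → Matrix (Option Y) (Option Y) ℂ} {ρ : ℝ} (hK : ∀ x, RowBound (K x) ρ)
    (hc : ∀ x, IsContr (K x)) (hρ : 0 ≤ ρ) {φ : (X → Option Y) → ℂ}
    (hφ : ∀ D, HasCollision D → φ D = 0) (hm : ∀ D, m < (pdom D).card → φ D = 0) :
    ∑ D with HasCollision D, ‖prodOp S K φ D‖ ^ 2
      ≤ ρ * (k * (4 * k + m)) * ∑ D, ‖φ D‖ ^ 2 := by
  set N := ∑ D, ‖φ D‖ ^ 2 with hN
  have hN0 : 0 ≤ N := sum_nonneg fun _ _ => by positivity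
  have hφ' : ∀ {x x'}, x ≠ x' → ∀ D, SameValue x x' D → φ D = 0 := fun hx D hD =>
    hφ D ⟨_, _, hx, hD⟩
  -- A collision away from `S` is never created, so one of the two points may be taken in `S`.
  have union : ∑ D with HasCollision D, ‖prodOp S K φ D‖ ^ 2
      ≤ ∑ x ∈ S, ∑ x' ∈ univ.erase x, ∑ D with SameValue x x' D, ‖prodOp S K φ D‖ ^ 2 := by
    have : ∀ x ∈ S, ∀ x' : X, ∀ D : X → Option Y, x ≠ x' → SameValue x x' D →
        ‖prodOp S K φ D‖ ^ 2 ≤ ∑ x ∈ S, ∑ x' ∈ univ.erase x,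
          if SameValue x x' D then ‖prodOp S K φ D‖ ^ 2 else 0 := by
      intro x hxS x' D hx hD
      refine le_trans ?_ (single_le_sum (fun _ _ => sum_nonneg fun _ _ => ?_) hxS)
      · refine le_trans ?_ (single_le_sum (fun _ _ => ?_) (mem_erase.2 ⟨hx.symm, mem_univ x'⟩))
        · rw [if_pos hD]
        · split_ifs <;> positivity
      · split_ifs <;> positivity
    simp only [sum_filter (p := fun D => SameValue _ _ D)]
    have swap : (∑ x ∈ S, ∑ x' ∈ univ.erase x, ∑ D : X → Option Y,
        if SameValue x x' D then ‖prodOp S K φ D‖ ^ 2 else 0)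
        = ∑ D : X → Option Y, ∑ x ∈ S, ∑ x' ∈ univ.erase x,
          if SameValue x x' D then ‖prodOp S K φ D‖ ^ 2 else 0 := by
      symm
      rw [sum_comm]
      exact sum_congr rfl fun x _ => sum_comm
    rw [swap, sum_filter]
    refine sum_le_sum fun D _ => ?_
    split_ifs with hD
    · obtain ⟨x, x', hx, hD⟩ := hD
      by_cases hxS : x ∈ S
      · exact this x hxS x' D hx hD
      by_cases hxS' : x' ∈ S
      · exact this x' hxS' x D hx.symm (sameValue_comm.1 hD)
      · rw [prodOp_eq_zero_of_forall_update (P := SameValue x x') K (fun z hz D d hD =>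
          (sameValue_update_iff (ne_of_mem_of_not_mem hz hxS)
            (ne_of_mem_of_not_mem hz hxS') D d).2 hD) (hφ' hx) D hD]
        simp only [norm_zero, ne_eq, OfNat.ofNat_ne_zero, not_false_eq_true, zero_pow, ite_self,
          sum_const_zero, le_refl]
    · exact sum_nonneg fun _ _ => sum_nonneg fun _ _ => by split_ifs <;> positivity
  have each : ∀ x ∈ S, ∑ x' ∈ univ.erase x, ∑ D with SameValue x x' D, ‖prodOp S K φ D‖ ^ 2
      ≤ ρ * (4 * k + m) * N := by
    intro x hxS
    set G := prodOp (S.erase x) K φ with hG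
    have hSG : prodOp S K φ = localOp x (K x) G := by
      rw [← mul_prodOp_erase hxS]
      rfl
    have hGN : ∑ D, ‖G D‖ ^ 2 ≤ N := prodOp_contr _ hc φ
    have inner : ∑ x' ∈ S.erase x, ∑ D with SameValue x x' D, ‖prodOp S K φ D‖ ^ 2
        ≤ k * (4 * ρ * N) := by
      refine (sum_le_card_nsmul _ _ (4 * ρ * N) fun x' hx' => ?_).trans ?_
      · obtain ⟨h1, h2⟩ := mem_erase.1 hx'
        exact sum_sameValue_prodOp_le_of_mem hxS h2 h1.symm hK hc hρ (hφ' h1.symm)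
      · rw [nsmul_eq_mul]
        gcongr
        exact (card_le_card (erase_subset _ _)).trans hS
    have outer : ∑ x' ∈ Sᶜ, ∑ D with SameValue x x' D, ‖prodOp S K φ D‖ ^ 2 ≤ ρ * (m * N) := by
      have h1 : ∀ x' ∈ Sᶜ, ∑ D with SameValue x x' D, ‖prodOp S K φ D‖ ^ 2
          ≤ ρ * ∑ D with D x' ≠ none, ‖G D‖ ^ 2 := by
        intro x' hx'
        rw [mem_compl] at hx'
        have hx : x ≠ x' := ne_of_mem_of_not_mem hxS hx'
        rw [hSG]
        refine sum_sameValue_localOp_le hx (hK x) hρ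
          (prodOp_eq_zero_of_forall_update K (fun z hz D d hD => ?_) (hφ' hx))
        obtain ⟨hz1, hz2⟩ := mem_erase.1 hz
        exact (sameValue_update_iff hz1 (ne_of_mem_of_not_mem hz2 hx') D d).2 hD
      refine (sum_le_sum h1).trans ?_
      rw [← mul_sum]
      gcongr
      simp only [sum_filter]
      rw [sum_comm]
      -- Operators on factors in `S` do not change the part of the domain outside `S`.
      have h2 : ∀ D, m < (pdom D \ S).card → G D = 0 := by
        refine prodOp_eq_zero_of_forall_update K (fun z hz D d hD => ?_) fun D hD =>
          hm D (hD.trans_le (card_le_card sdiff_subset))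
        convert hD using 2
        ext j
        have : j ∉ S → j ≠ z := fun hj => (ne_of_mem_of_not_mem (mem_of_mem_erase hz) hj).symm
        simp only [mem_sdiff, mem_pdom]
        refine and_congr_left fun hj => ?_
        rw [update_of_ne (this hj)]
      refine le_trans (sum_le_sum fun D _ => ?_) ((mul_sum _ _ _).symm.le.trans
        (mul_le_mul_of_nonneg_left hGN (Nat.cast_nonneg m)))
      rw [← sum_filter, sum_const, nsmul_eq_mul]
      have h3 : ({x' ∈ Sᶜ | D x' ≠ none} : Finset X) = pdom D \ S := by
        ext j
        simp [mem_pdom, and_comm]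
      rw [h3]
      by_cases hD : m < (pdom D \ S).card
      · rw [h2 D hD]
        simp
      · gcongr
        exact not_lt.1 hD
    have split : univ.erase x = S.erase x ∪ Sᶜ := by
      ext j
      by_cases hj : j ∈ S
      · simp [hj]
      · simp [hj, (ne_of_mem_of_not_mem hxS hj).symm]
    rw [split, sum_union (disjoint_left.2 fun j hj => by
      simpa using mem_of_mem_erase hj)]
    linarith
  refine union.trans ((sum_le_card_nsmul _ _ _ each).trans ?_)
  rw [nsmul_eq_mul]
  have : (S.card : ℝ) * (ρ * (4 * k + m) * N) ≤ k * (ρ * (4 * k + m) * N) := by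
    gcongr
  linarith

/-- Operators on `k` factors enlarge the domains by at most `k` points. -/
theorem prodOp_eq_zero_of_card_pdom {S : Finset X} {k m : ℕ} (hS : S.card ≤ k)
    (K : X → Matrix (Option Y) (Option Y) ℂ) {φ : (X → Option Y) → ℂ}
    (hm : ∀ D, m < (pdom D).card → φ D = 0) (D : X → Option Y) (hD : m + k < (pdom D).card) :
    prodOp S K φ D = 0 := by
  refine prodOp_eq_zero_of_forall_update (P := fun D => m < (pdom D \ S).card) K
    (fun z hz D d hD => ?_) (fun D hD => hm D (hD.trans_le (card_le_card sdiff_subset))) D ?_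
  · convert hD using 2
    ext j
    simp only [mem_sdiff, mem_pdom]
    refine and_congr_left fun hj => ?_
    rw [update_of_ne (ne_of_mem_of_not_mem hz hj).symm]
  · have := le_card_sdiff S (pdom D)
    omega

end Collisions

/-! ### The compression of the oracle -/

section Compression

variable {X Y : Type*} [Fintype X] [DecidableEq X] [Fintype Y] [DecidableEq Y]

/-- The vector `|⊥⟩ - M^{-1/2} ∑ y, |y⟩`, of square norm `2`. -/
noncomputable def reflVec (Y : Type*) [Fintype Y] : Option Y → ℂ
  | none => 1
  | some _ => -((√(Fintype.card Y : ℝ))⁻¹ : ℝ)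

/-- The compression unitary of one factor: the reflection of `ℂ[Y ∪ {⊥}]` that exchanges `|⊥⟩`
with the uniform superposition of the values. -/
noncomputable def compMat (Y : Type*) [Fintype Y] [DecidableEq Y] :
    Matrix (Option Y) (Option Y) ℂ :=
  1 - Matrix.vecMulVec (reflVec Y) (reflVec Y)

theorem norm_reflVec_some_sq (y : Y) : ‖reflVec Y (some y)‖ ^ 2 = 1 / Fintype.card Y := by
  simp only [reflVec, norm_neg, Complex.norm_real, Real.norm_eq_abs, sq_abs, inv_pow]
  rw [Real.sq_sqrt (Nat.cast_nonneg _), one_div]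

theorem star_reflVec : star (reflVec Y) = reflVec Y := by
  ext d
  cases d <;> simp [reflVec]

theorem sum_norm_reflVec_sq [Nonempty Y] : ∑ d, ‖reflVec Y d‖ ^ 2 = 2 := by
  have : (Fintype.card Y : ℝ) ≠ 0 := by simp
  rw [Fintype.sum_option]
  simp only [norm_reflVec_some_sq, sum_const, card_univ, nsmul_eq_mul]
  field_simp
  norm_num [reflVec]

theorem reflVec_dotProduct_self [Nonempty Y] : reflVec Y ⬝ᵥ reflVec Y = 2 := by
  have h : reflVec Y ⬝ᵥ reflVec Y = ((∑ d, ‖reflVec Y d‖ ^ 2 : ℝ) : ℂ) := by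
    rw [dotProduct, Complex.ofReal_sum]
    refine sum_congr rfl fun d _ => ?_
    rw [Complex.ofReal_pow, ← Complex.conj_mul']
    congr 1
    exact (congrFun star_reflVec d).symm
  rw [h, sum_norm_reflVec_sq]
  norm_num

theorem compMat_apply (d e : Option Y) :
    compMat Y d e = (if d = e then 1 else 0) - reflVec Y d * reflVec Y e := by
  simp [compMat, Matrix.one_apply, Matrix.vecMulVec_apply]

theorem compMat_comm (d e : Option Y) : compMat Y d e = compMat Y e d := by
  simp only [compMat_apply, eq_comm, mul_comm]

theorem compMat_mul_self [Nonempty Y] : compMat Y * compMat Y = 1 := by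
  simp only [compMat, sub_mul, mul_sub, Matrix.one_mul, Matrix.mul_one,
    Matrix.vecMulVec_mul_vecMulVec, reflVec_dotProduct_self]
  ext d e
  simp [Matrix.vecMulVec_apply]
  ring

theorem compMat_conjTranspose : (compMat Y).conjTranspose = compMat Y := by
  ext d e
  rw [Matrix.conjTranspose_apply, compMat_apply, compMat_apply, star_sub, star_mul']
  have h : ∀ d, star (reflVec Y d) = reflVec Y d := fun d => congrFun star_reflVec d
  rw [h, h, mul_comm, apply_ite star]
  simp [eq_comm]

theorem isContr_compMat [Nonempty Y] : IsContr (compMat Y) := by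
  intro v
  have h : star ((compMat Y).mulVec v) ⬝ᵥ (compMat Y).mulVec v = star v ⬝ᵥ v := by
    rw [Matrix.star_mulVec, compMat_conjTranspose, Matrix.dotProduct_mulVec,
      Matrix.vecMul_vecMul, compMat_mul_self, Matrix.vecMul_one]
  have e : ∀ u : Option Y → ℂ, star u ⬝ᵥ u = ((∑ d, ‖u d‖ ^ 2 : ℝ) : ℂ) := by
    intro u
    rw [dotProduct, Complex.ofReal_sum]
    refine sum_congr rfl fun d _ => ?_
    rw [Complex.ofReal_pow, ← Complex.conj_mul']
    rfl
  rw [e, e, Complex.ofReal_inj] at h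
  exact h.le

theorem sum_erase_le (d : Option Y) (F : Option Y → ℝ) (hF : ∀ d, 0 ≤ F d) :
    ∑ e ∈ univ.erase d, F e ≤ ∑ e, F e :=
  sum_le_sum_of_subset_of_nonneg (subset_univ _) fun _ _ _ => hF _

theorem rowBound_compMat [Nonempty Y] : RowBound (compMat Y) (2 / Fintype.card Y) := by
  intro y
  calc ∑ d ∈ univ.erase (some y), ‖compMat Y (some y) d‖ ^ 2
      = ∑ d ∈ univ.erase (some y), 1 / (Fintype.card Y : ℝ) * ‖reflVec Y d‖ ^ 2 := by
        refine sum_congr rfl fun d hd => ?_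
        rw [compMat_apply, if_neg (ne_of_mem_erase hd).symm, zero_sub, norm_neg, norm_mul,
          mul_pow, norm_reflVec_some_sq]
    _ ≤ ∑ d, 1 / (Fintype.card Y : ℝ) * ‖reflVec Y d‖ ^ 2 :=
        sum_erase_le _ _ fun _ => by positivity
    _ = 2 / Fintype.card Y := by
        rw [← mul_sum, sum_norm_reflVec_sq]
        ring

/-- A diagonal phase, conjugated by the compression, writes a value over something else only
with small amplitude. -/
theorem rowBound_conj_compMat [Nonempty Y] {g : Option Y → ℂ} (hg : ∀ d, ‖g d‖ = 1) :
    RowBound (compMat Y * Matrix.diagonal g * compMat Y) (8 / Fintype.card Y) := by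
  intro y
  set v := reflVec Y with hv
  set u : Option Y → ℂ := (compMat Y).mulVec fun a => g a * v a with hu
  have hu2 : ∑ d, ‖u d‖ ^ 2 ≤ 2 := by
    refine (isContr_compMat _).trans (le_of_eq ?_)
    simp only [norm_mul, hg, one_mul]
    exact sum_norm_reflVec_sq
  -- The row of the conjugated phase, from `compMat (some y) a = δ - v (some y) * v a`
  have entry : ∀ d, (compMat Y * Matrix.diagonal g * compMat Y) (some y) d
      = g (some y) * compMat Y (some y) d - v (some y) * u d := by
    intro d
    rw [Matrix.mul_apply]
    simp only [Matrix.mul_diagonal, hu, Matrix.mulVec, dotProduct]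
    rw [mul_sum]
    have : ∀ a, compMat Y (some y) a * g a * compMat Y a d
        = (if some y = a then g a * compMat Y a d else 0)
          - v (some y) * (compMat Y d a * (g a * v a)) := by
      intro a
      rw [compMat_apply (some y) a, compMat_comm d a]
      split_ifs <;> ring
    rw [sum_congr rfl fun a _ => this a, sum_sub_distrib, sum_ite_eq]
    simp
  have bound : ∀ d ∈ univ.erase (some y),
      ‖(compMat Y * Matrix.diagonal g * compMat Y) (some y) d‖ ^ 2
        ≤ 2 / (Fintype.card Y : ℝ) * (‖v d‖ ^ 2 + ‖u d‖ ^ 2) := by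
    intro d hd
    rw [entry, compMat_apply, if_neg (ne_of_mem_erase hd).symm, sub_eq_add_neg]
    refine (norm_add_sq_le_two_mul _ _).trans (le_of_eq ?_)
    rw [zero_sub, norm_neg, norm_mul, norm_neg, norm_mul, norm_mul, hg, mul_pow, mul_pow, mul_pow,
      norm_reflVec_some_sq]
    ring
  refine (sum_le_sum bound).trans ((sum_erase_le _ _ fun d => by positivity).trans ?_)
  rw [← mul_sum, sum_add_distrib, sum_norm_reflVec_sq]
  calc 2 / (Fintype.card Y : ℝ) * (2 + ∑ d, ‖u d‖ ^ 2) ≤ 2 / (Fintype.card Y : ℝ) * (2 + 2) := by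
        gcongr
    _ = 8 / Fintype.card Y := by ring

theorem some_comp_injective : Injective fun H : X → Y => (fun x => some (H x) : X → Option Y) :=
  fun _ _ h => funext fun x => Option.some_injective _ (congrFun h x)

/-- A function of `H : X → Y` as a function of partial functions, supported on total ones. -/
noncomputable def extendTotal : ((X → Y) → ℂ) →ₗ[ℂ] ((X → Option Y) → ℂ) :=
  ExtendByZero.linearMap ℂ fun H x => some (H x)

theorem extendTotal_some (f : (X → Y) → ℂ) (H : X → Y) :
    extendTotal f (fun x => some (H x)) = f H :=
  some_comp_injective.extend_apply f (0 : (X → Option Y) → ℂ) H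

theorem extendTotal_eq_zero (f : (X → Y) → ℂ) {D : X → Option Y}
    (hD : ¬ ∃ H : X → Y, (fun x => some (H x)) = D) : extendTotal f D = 0 :=
  extend_apply' f (0 : (X → Option Y) → ℂ) D hD

theorem sum_norm_extendTotal_sq (f : (X → Y) → ℂ) :
    ∑ D, ‖extendTotal f D‖ ^ 2 = ∑ H, ‖f H‖ ^ 2 := by
  refine (Fintype.sum_of_injective _ some_comp_injective _ _ (fun D hD => ?_) fun H => ?_).symm
  · rw [extendTotal_eq_zero f (by simpa using hD)]
    simp
  · rw [extendTotal_some]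

/-- The compressed form of a function of the oracle `H`: its amplitudes in the basis of partial
functions, after the compression of every factor. -/
noncomputable def compress : ((X → Y) → ℂ) →ₗ[ℂ] ((X → Option Y) → ℂ) :=
  prodOp univ (fun _ => compMat Y) ∘ₗ extendTotal

theorem compress_apply (f : (X → Y) → ℂ) :
    compress f = prodOp univ (fun _ => compMat Y) (extendTotal f) := rfl

theorem prodOp_compress [Nonempty Y] (f : (X → Y) → ℂ) :
    prodOp univ (fun _ => compMat Y) (compress f) = extendTotal f := by
  rw [compress_apply, ← Module.End.mul_apply, prodOp_mul_self fun _ => compMat_mul_self]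
  rfl

theorem sum_norm_compress_sq_le [Nonempty Y] (f : (X → Y) → ℂ) :
    ∑ D, ‖compress f D‖ ^ 2 ≤ ∑ H, ‖f H‖ ^ 2 := by
  exact (prodOp_contr univ (fun _ => isContr_compMat) _).trans_eq (sum_norm_extendTotal_sq f)

/-- The compression of the uniform superposition of the values has no component on a value. -/
theorem sum_compMat_some_some [Nonempty Y] (d : Y) :
    ∑ y : Y, compMat Y (some d) (some y) = 0 := by
  have h : (Fintype.card Y : ℝ) ≠ 0 := by simp
  simp only [compMat_apply, sum_sub_distrib, Option.some.injEq, sum_ite_eq, mem_univ, if_true,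
    reflVec, sum_const, card_univ, nsmul_eq_mul]
  rw [neg_mul_neg, ← Complex.ofReal_mul, ← mul_inv, Real.mul_self_sqrt (Nat.cast_nonneg _)]
  push_cast
  rw [mul_inv_cancel₀ (by exact_mod_cast h), sub_self]

/-- Compressed, a function that does not depend on the oracle is supported on the nowhere defined
partial function. -/
theorem compress_const_eq_zero [Nonempty Y] (c : ℂ) {D : X → Option Y} (hD : (pdom D).Nonempty) :
    compress (fun _ => c) D = 0 := by
  obtain ⟨x, hx⟩ := hD
  rw [mem_pdom] at hx
  have h : ∀ D : X → Option Y, D x ≠ none →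
      localOp x (compMat Y) (extendTotal fun _ => c) D = 0 := by
    intro D hx
    obtain ⟨d, hd⟩ := Option.ne_none_iff_exists'.1 hx
    rw [localOp_apply, Fintype.sum_option, hd]
    by_cases hD : ∀ z, z ≠ x → D z ≠ none
    · have hval : ∀ y, (extendTotal fun _ : X → Y => c) (update D x (some y)) = c := by
        intro y
        have : ∀ z, ∃ w, update D x (some y) z = some w := by
          intro z
          by_cases hz : z = x
          · exact ⟨y, by rw [hz, update_self]⟩
          · rw [update_of_ne hz]
            exact Option.ne_none_iff_exists'.1 (hD z hz)
        choose H hH using this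
        rw [show update D x (some y) = fun z => some (H z) from funext hH]
        exact extendTotal_some _ H
      rw [extendTotal_eq_zero _ (by
        rintro ⟨H, hH⟩
        simpa using congrFun hH x)]
      simp only [hval, ← sum_mul, sum_compMat_some_some]
      simp
    · push Not at hD
      obtain ⟨z, hz, hz'⟩ := hD
      have hval : ∀ y, (extendTotal fun _ : X → Y => c) (update D x y) = 0 := by
        intro y
        refine extendTotal_eq_zero _ ?_
        rintro ⟨H, hH⟩
        have := congrFun hH z
        rw [update_of_ne hz, hz'] at this
        simp at this
      simp [hval]
  rw [compress_apply, ← mul_prodOp_erase (mem_univ x),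
    (localOp_commute_prodOp (notMem_erase x univ) _ _).eq]
  exact prodOp_eq_zero_of_forall_update (P := fun D => D x ≠ none) _
    (fun z hz D d hD => by rwa [update_of_ne (ne_of_mem_erase hz).symm]) h D hx

/-- Multiplication by phases that depend on the values at the points of `S`, in compressed form. -/
theorem compress_prod_mul [Nonempty Y] (S : Finset X) (g : X → Y → ℂ) (f : (X → Y) → ℂ) :
    compress (fun H => (∏ x ∈ S, g x (H x)) * f H)
      = prodOp S (fun x => compMat Y * Matrix.diagonal (fun d => d.elim 1 (g x)) * compMat Y)
        (compress f) := by
  have h : extendTotal (fun H => (∏ x ∈ S, g x (H x)) * f H)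
      = prodOp S (fun x => Matrix.diagonal fun d : Option Y => d.elim 1 (g x))
        (extendTotal f) := by
    ext D
    rw [prodOp_diagonal]
    by_cases hD : ∃ H : X → Y, (fun x => some (H x)) = D
    · obtain ⟨H, rfl⟩ := hD
      simp only [extendTotal_some, Option.elim_some]
    · rw [extendTotal_eq_zero _ hD, extendTotal_eq_zero _ hD, mul_zero]
  rw [compress_apply, h, ← Module.End.mul_apply, prodOp_univ_mul_prodOp compMat_mul_self]
  rfl

/-- One application of phases at `k` points increases the amplitude of collisions by
`O(√(k (k + m) / M))`. -/
theorem sqrt_hasCollision_compress_prod_mul_le [Nonempty Y] {S : Finset X} {k m : ℕ}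
    (hS : S.card ≤ k) {g : X → Y → ℂ} (hg : ∀ x y, ‖g x y‖ = 1) {f : (X → Y) → ℂ}
    (hm : ∀ D, m < (pdom D).card → compress f D = 0) :
    √(∑ D with HasCollision D, ‖compress (fun H => (∏ x ∈ S, g x (H x)) * f H) D‖ ^ 2)
      ≤ √(∑ D with HasCollision D, ‖compress f D‖ ^ 2)
        + √(8 / Fintype.card Y * (k * (4 * k + m))) * √(∑ H, ‖f H‖ ^ 2) := by
  have hg' : ∀ x, ∀ d : Option Y, ‖d.elim 1 (g x)‖ = 1 := by
    rintro x (_ | y)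
    · simp
    · simpa using hg x y
  set K := fun x => compMat Y * Matrix.diagonal (fun d : Option Y => d.elim 1 (g x)) * compMat Y
    with hK
  have hc : ∀ x, IsContr (K x) := fun x =>
    (isContr_compMat.mul (isContr_diagonal (hg' x))).mul isContr_compMat
  set bad : (X → Option Y) → ℂ := fun D => if HasCollision D then compress f D else 0 with hbad
  set good : (X → Option Y) → ℂ := fun D => if HasCollision D then 0 else compress f D with hgood
  have hsplit : compress f = bad + good := by
    ext D
    simp only [hbad, hgood, Pi.add_apply]
    split_ifs <;> simp
  rw [compress_prod_mul]
  simp only [hsplit, map_add, Pi.add_apply]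
  refine (sqrt_sum_norm_add_sq_le _ _ _).trans (add_le_add ?_ ?_)
  · refine Real.sqrt_le_sqrt ?_
    calc ∑ D with HasCollision D, ‖prodOp S K bad D‖ ^ 2
        ≤ ∑ D, ‖prodOp S K bad D‖ ^ 2 :=
          sum_le_sum_of_subset_of_nonneg (subset_univ _) fun _ _ _ => by positivity
      _ ≤ ∑ D, ‖bad D‖ ^ 2 := prodOp_contr S hc bad
      _ = ∑ D with HasCollision D, ‖bad D + good D‖ ^ 2 := by
          rw [sum_filter]
          refine sum_congr rfl fun D _ => ?_
          by_cases h : HasCollision D <;> simp only [hbad, hgood, h, if_true, if_false] <;> simp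
  · rw [← Real.sqrt_mul (by positivity)]
    refine Real.sqrt_le_sqrt ?_
    refine (sum_hasCollision_prodOp_le hS (fun x => rowBound_conj_compMat (hg' x)) hc
      (by positivity) (φ := good) (fun D hD => if_pos hD) (m := m) (fun D hD => ?_)).trans ?_
    · simp [hgood, hm D hD]
    · gcongr
      refine le_trans (sum_le_sum fun D _ => ?_) (sum_norm_compress_sq_le f)
      simp only [hgood]
      split_ifs
      · simp
      · rfl

/-- The amplitude of a collision of the actual oracle at a given pair of points exceeds that of
a collision of the compressed oracle by `O(√(1 / M))`. -/
theorem sqrt_collision_le [Nonempty Y] {x x' : X} (hx : x ≠ x') (f : (X → Y) → ℂ) :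
    √(∑ H with H x = H x', ‖f H‖ ^ 2)
      ≤ √(∑ D with HasCollision D, ‖compress f D‖ ^ 2)
        + √(4 * (2 / Fintype.card Y)) * √(∑ H, ‖f H‖ ^ 2) := by
  set T := prodOp (univ : Finset X) (fun _ => compMat Y) with hT
  have hc : ∀ _ : X, IsContr (compMat Y) := fun _ => isContr_compMat
  set bad : (X → Option Y) → ℂ := fun D => if SameValue x x' D then compress f D else 0 with hbad
  set good : (X → Option Y) → ℂ := fun D => if SameValue x x' D then 0 else compress f D
    with hgood
  have hsplit : compress f = bad + good := by
    ext D
    simp only [hbad, hgood, Pi.add_apply]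
    split_ifs <;> simp
  have h0 : ∑ H with H x = H x', ‖f H‖ ^ 2
      ≤ ∑ D with SameValue x x' D, ‖T bad D + T good D‖ ^ 2 := by
    have : ∀ D, T bad D + T good D = extendTotal f D := by
      intro D
      rw [← prodOp_compress, hsplit, map_add, Pi.add_apply]
    simp only [this]
    rw [sum_filter, sum_filter]
    refine le_of_eq (Fintype.sum_of_injective _ some_comp_injective _ _ (fun D hD => ?_) fun H => ?_)
    · rw [extendTotal_eq_zero f (by simpa using hD)]
      simp
    · rw [extendTotal_some]
      simp [SameValue]
  refine (Real.sqrt_le_sqrt h0).trans ((sqrt_sum_norm_add_sq_le _ _ _).trans (add_le_add ?_ ?_))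
  · refine Real.sqrt_le_sqrt ?_
    calc ∑ D with SameValue x x' D, ‖T bad D‖ ^ 2
        ≤ ∑ D, ‖T bad D‖ ^ 2 :=
          sum_le_sum_of_subset_of_nonneg (subset_univ _) fun _ _ _ => by positivity
      _ ≤ ∑ D, ‖bad D‖ ^ 2 := prodOp_contr _ hc bad
      _ ≤ ∑ D with HasCollision D, ‖compress f D‖ ^ 2 := by
          rw [sum_filter]
          refine sum_le_sum fun D _ => ?_
          by_cases h : SameValue x x' D
          · rw [if_pos ⟨x, x', hx, h⟩]
            simp only [hbad]
            rw [if_pos h]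
          · simp only [hbad, h, if_false]
            split_ifs <;> simp
  · rw [← Real.sqrt_mul (by positivity)]
    refine Real.sqrt_le_sqrt ((sum_sameValue_prodOp_le_of_mem (mem_univ x) (mem_univ x') hx
      (fun _ => rowBound_compMat) hc (by positivity) (φ := good) fun D hD => if_pos hD).trans ?_)
    gcongr
    refine le_trans (sum_le_sum fun D _ => ?_) (sum_norm_compress_sq_le f)
    simp only [hgood]
    split_ifs
    · simp
    · rfl

end Compression

/-! ### The Fourier transform of the response registers -/

theorem sum_addChar_norm_sum_sq {G : Type*} [AddCommGroup G] [Fintype G] (f : G → ℂ) :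
    ∑ χ : AddChar G ℂ, ‖∑ y, χ y * f y‖ ^ 2 = Fintype.card G * ∑ y, ‖f y‖ ^ 2 := by
  classical
  rw [← Complex.ofReal_inj]
  push_cast
  simp only [← Complex.conj_mul', map_sum, map_mul, sum_mul_sum]
  have h : ∀ χ : AddChar G ℂ, ∀ y z : G,
      (starRingEnd ℂ) (χ y) * (starRingEnd ℂ) (f y) * (χ z * f z)
        = (starRingEnd ℂ) (f y) * f z * χ (z - y) := by
    intro χ y z
    rw [sub_eq_add_neg, AddChar.map_add_eq_mul, AddChar.map_neg_eq_conj]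
    ring
  simp only [h]
  rw [sum_comm, mul_sum]
  refine sum_congr rfl fun y _ => ?_
  rw [sum_comm]
  simp only [← mul_sum, AddChar.sum_apply_eq_ite, sub_eq_zero, mul_ite, mul_zero, sum_ite_eq',
    mem_univ, if_true]
  ring

theorem addChar_map_sum {G ι : Type*} [AddCommGroup G] (χ : AddChar G ℂ) (s : Finset ι)
    (f : ι → G) : χ (∑ i ∈ s, f i) = ∏ i ∈ s, χ (f i) := by
  classical
  induction s using Finset.induction_on with
  | empty => simp
  | insert i s hi ih => rw [sum_insert hi, prod_insert hi, AddChar.map_add_eq_mul, ih]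

section Query

variable {X Y : Type*} [Fintype X] [DecidableEq X] [Fintype Y] [DecidableEq Y] [AddCommGroup Y]
  {k d : ℕ}

/-- The normalized Fourier transform of the response registers. It diagonalizes the queries to
all oracles at once. -/
noncomputable def fourierY :
    EuclideanSpace ℂ (QReg X Y k d) →ₗ[ℂ]
      ((Fin k → X) × AddChar (Fin k → Y) ℂ × Fin d → ℂ) where
  toFun v r := ((√(Fintype.card (Fin k → Y) : ℝ))⁻¹ : ℝ) * ∑ y, r.2.1 y * v (r.1, y, r.2.2)
  map_add' u v := by
    ext r
    simp [mul_add, sum_add_distrib]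
  map_smul' c v := by
    ext r
    simp only [PiLp.smul_apply, smul_eq_mul, RingHom.id_apply, Pi.smul_apply, mul_sum]
    exact sum_congr rfl fun y _ => by ring

theorem fourierY_apply (v : EuclideanSpace ℂ (QReg X Y k d)) (x : Fin k → X)
    (χ : AddChar (Fin k → Y) ℂ) (w : Fin d) :
    fourierY v (x, χ, w)
      = ((√(Fintype.card (Fin k → Y) : ℝ))⁻¹ : ℝ) * ∑ y, χ y * v (x, y, w) := rfl

theorem sum_norm_fourierY_sq (v : EuclideanSpace ℂ (QReg X Y k d)) :
    ∑ r, ‖fourierY v r‖ ^ 2 = ‖v‖ ^ 2 := by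
  rw [EuclideanSpace.norm_sq_eq, Fintype.sum_prod_type, Fintype.sum_prod_type]
  refine sum_congr rfl fun x _ => ?_
  rw [Fintype.sum_prod_type_right, Fintype.sum_prod_type_right]
  refine sum_congr rfl fun w _ => ?_
  have h : (Fintype.card (Fin k → Y) : ℝ) ≠ 0 := by
    have : Nonempty (Fin k → Y) := ⟨0⟩
    exact_mod_cast Fintype.card_ne_zero
  simp only [fourierY_apply, norm_mul, mul_pow, ← mul_sum, sum_addChar_norm_sum_sq]
  rw [Complex.norm_real, Real.norm_eq_abs, sq_abs, inv_pow, Real.sq_sqrt (Nat.cast_nonneg _),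
    inv_mul_cancel_left₀ h]

theorem parallelQuery_apply (H : X → Y) (v : EuclideanSpace ℂ (QReg X Y k d)) (x : Fin k → X)
    (y : Fin k → Y) (w : Fin d) : parallelQuery H v (x, y, w) = v (x, y - H ∘ x, w) := rfl

/-- The phase of a character on `H(x) = (H(x₁), …, H(x_k))` splits into phases that each depend on
one value of `H`; points that occur several times in `x` contribute once. -/
theorem addChar_comp_eq_prod (χ : AddChar (Fin k → Y) ℂ) (x : Fin k → X) (H : X → Y) :
    χ (H ∘ x) = ∏ z ∈ univ.image x, χ (fun i => if x i = z then H z else 0) := by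
  rw [← addChar_map_sum]
  congr 1
  ext i
  rw [Finset.sum_apply, sum_ite_eq, if_pos (mem_image_of_mem x (mem_univ i))]
  rfl

theorem fourierY_parallelQuery (H : X → Y) (v : EuclideanSpace ℂ (QReg X Y k d))
    (x : Fin k → X) (χ : AddChar (Fin k → Y) ℂ) (w : Fin d) :
    fourierY (parallelQuery H v) (x, χ, w)
      = (∏ z ∈ univ.image x, χ (fun i => if x i = z then H z else 0)) * fourierY v (x, χ, w) := by
  rw [← addChar_comp_eq_prod, fourierY_apply, fourierY_apply, mul_left_comm, mul_sum _ _ (χ _)]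
  congr 1
  rw [← Equiv.sum_comp (Equiv.addRight (H ∘ x))]
  refine sum_congr rfl fun y _ => ?_
  rw [parallelQuery_apply, Equiv.coe_addRight, add_sub_cancel_right, AddChar.map_add_eq_mul]
  ring

end Query

/-! ### The progress of an algorithm -/

section Progress

variable {X Y : Type*} [Fintype X] [DecidableEq X] [Fintype Y] [DecidableEq Y]

/-- The compression of a vector-valued function of the oracle, i.e. of a joint state of an
algorithm and the oracle. -/
noncomputable def vecCompress {V : Type*} [AddCommGroup V] [Module ℂ V] (Ψ : (X → Y) → V)
    (D : X → Option Y) : V :=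
  ∑ H, compress (Pi.single H 1) D • Ψ H

theorem map_vecCompress {V V' : Type*} [AddCommGroup V] [Module ℂ V] [AddCommGroup V']
    [Module ℂ V'] (L : V →ₗ[ℂ] V') (Ψ : (X → Y) → V) (D : X → Option Y) :
    L (vecCompress Ψ D) = vecCompress (fun H => L (Ψ H)) D := by
  simp [vecCompress]

theorem vecCompress_eq_compress (f : (X → Y) → ℂ) (D : X → Option Y) :
    vecCompress f D = compress f D := by
  conv_rhs => rw [← univ_sum_single f, map_sum, Finset.sum_apply]
  refine sum_congr rfl fun H _ => ?_
  rw [show (Pi.single H (f H) : (X → Y) → ℂ) = f H • Pi.single H 1 by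
    rw [← Pi.single_smul, smul_eq_mul, mul_one], map_smul, Pi.smul_apply, smul_eq_mul, smul_eq_mul,
    mul_comm]

/-- The square of the amplitude of collisions in the compressed oracle, for the joint state `Ψ`. -/
noncomputable def collWeight {E : Type*} [NormedAddCommGroup E] [Module ℂ E]
    (Ψ : (X → Y) → E) : ℝ :=
  ∑ D with HasCollision D, ‖vecCompress Ψ D‖ ^ 2

theorem collWeight_map {E : Type*} [NormedAddCommGroup E] [NormedSpace ℂ E]
    (U : E ≃ₗᵢ[ℂ] E) (Ψ : (X → Y) → E) : collWeight (fun H => U (Ψ H)) = collWeight Ψ := by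
  refine sum_congr rfl fun D _ => ?_
  rw [← U.norm_map (vecCompress Ψ D)]
  congr 2
  exact (map_vecCompress U.toLinearEquiv.toLinearMap Ψ D).symm

variable [AddCommGroup Y] {k d : ℕ}

theorem fourierY_vecCompress (Ψ : (X → Y) → EuclideanSpace ℂ (QReg X Y k d))
    (D : X → Option Y) (r : (Fin k → X) × AddChar (Fin k → Y) ℂ × Fin d) :
    fourierY (vecCompress Ψ D) r = compress (fun H => fourierY (Ψ H) r) D := by
  rw [← vecCompress_eq_compress]
  exact map_vecCompress (LinearMap.proj r ∘ₗ fourierY) Ψ D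

theorem vecCompress_apply (Ψ : (X → Y) → EuclideanSpace ℂ (QReg X Y k d))
    (D : X → Option Y) (r : QReg X Y k d) :
    vecCompress Ψ D r = compress (fun H => Ψ H r) D := by
  rw [← vecCompress_eq_compress]
  exact map_vecCompress (EuclideanSpace.proj r : _ →L[ℂ] ℂ).toLinearMap Ψ D

theorem collWeight_eq_sum_fourierY (Ψ : (X → Y) → EuclideanSpace ℂ (QReg X Y k d)) :
    collWeight Ψ = ∑ r : (Fin k → X) × AddChar (Fin k → Y) ℂ × Fin d,
      ∑ D with HasCollision D, ‖compress (fun H => fourierY (Ψ H) r) D‖ ^ 2 := by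
  rw [collWeight, sum_comm]
  refine sum_congr rfl fun D _ => ?_
  rw [← sum_norm_fourierY_sq]
  simp only [fourierY_vecCompress]

theorem collWeight_eq_sum (Ψ : (X → Y) → EuclideanSpace ℂ (QReg X Y k d)) :
    collWeight Ψ = ∑ r : QReg X Y k d,
      ∑ D with HasCollision D, ‖compress (fun H => Ψ H r) D‖ ^ 2 := by
  rw [collWeight, sum_comm]
  refine sum_congr rfl fun D _ => ?_
  rw [EuclideanSpace.norm_sq_eq]
  simp only [vecCompress_apply]

/-- The compressed form of the joint state `Ψ` is supported on partial functions whose domain has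
at most `m` points. -/
def SizeLE {E : Type*} [AddCommGroup E] [Module ℂ E] (Ψ : (X → Y) → E) (m : ℕ) : Prop :=
  ∀ D, m < (pdom D).card → vecCompress Ψ D = 0

theorem SizeLE.compress_fourierY {Ψ : (X → Y) → EuclideanSpace ℂ (QReg X Y k d)} {m : ℕ}
    (hm : SizeLE Ψ m) (r : (Fin k → X) × AddChar (Fin k → Y) ℂ × Fin d) (D : X → Option Y)
    (hD : m < (pdom D).card) : compress (fun H => fourierY (Ψ H) r) D = 0 := by
  rw [← fourierY_vecCompress, hm D hD, map_zero]
  rfl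

theorem card_image_fin_le (x : Fin k → X) : (univ.image x).card ≤ k :=
  card_image_le.trans (by simp)

/-- A `k`-parallel query enlarges the domain by at most `k` points. -/
theorem SizeLE.parallelQuery {Ψ : (X → Y) → EuclideanSpace ℂ (QReg X Y k d)} {m : ℕ}
    (hm : SizeLE Ψ m) : SizeLE (fun H => parallelQuery H (Ψ H)) (m + k) := by
  have : Nonempty Y := ⟨0⟩
  intro D hD
  rw [← norm_eq_zero, ← sq_eq_zero_iff, ← sum_norm_fourierY_sq]
  refine sum_eq_zero ?_
  rintro ⟨x, χ, w⟩ -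
  rw [fourierY_vecCompress]
  simp only [fourierY_parallelQuery]
  rw [compress_prod_mul _ (fun z h => χ fun i => if x i = z then h else 0),
    prodOp_eq_zero_of_card_pdom (card_image_fin_le x) _ (hm.compress_fourierY (x, χ, w)) D hD]
  simp

/-- The growth of the amplitude of collisions in a `k`-parallel query. -/
theorem sqrt_collWeight_parallelQuery_le {Ψ : (X → Y) → EuclideanSpace ℂ (QReg X Y k d)} {m : ℕ}
    (hm : SizeLE Ψ m) :
    √(collWeight fun H => parallelQuery H (Ψ H))
      ≤ √(collWeight Ψ) + √(8 / Fintype.card Y * (k * (4 * k + m))) * √(∑ H, ‖Ψ H‖ ^ 2) := by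
  have : Nonempty Y := ⟨0⟩
  have hN : ∑ H, ‖Ψ H‖ ^ 2 = ∑ r, ∑ H, ‖fourierY (Ψ H) r‖ ^ 2 := by
    rw [sum_comm]
    simp only [sum_norm_fourierY_sq]
  rw [collWeight_eq_sum_fourierY, collWeight_eq_sum_fourierY, hN]
  refine sqrt_sum_le_of_sqrt_le _ (Real.sqrt_nonneg _)
    (fun _ => sum_nonneg fun _ _ => by positivity) (fun _ => sum_nonneg fun _ _ => by positivity)
    (fun _ => sum_nonneg fun _ _ => by positivity) ?_
  rintro ⟨x, χ, w⟩ -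
  simp only [fourierY_parallelQuery]
  exact sqrt_hasCollision_compress_prod_mul_le (card_image_fin_le x)
    (g := fun z h => χ fun i => if x i = z then h else 0) (fun _ _ => χ.norm_apply _)
    (hm.compress_fourierY (x, χ, w))

theorem SizeLE.map {E : Type*} [NormedAddCommGroup E] [NormedSpace ℂ E] {Ψ : (X → Y) → E} {m : ℕ}
    (hm : SizeLE Ψ m) (U : E ≃ₗᵢ[ℂ] E) : SizeLE (fun H => U (Ψ H)) m := by
  intro D hD
  have h := map_vecCompress U.toLinearEquiv.toLinearMap Ψ D
  rw [hm D hD, map_zero] at h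
  exact h.symm

theorem vecCompress_const_eq_zero (v : EuclideanSpace ℂ (QReg X Y k d)) {D : X → Option Y}
    (hD : (pdom D).Nonempty) : vecCompress (fun _ : X → Y => v) D = 0 := by
  have : Nonempty Y := ⟨0⟩
  ext r
  rw [vecCompress_apply, compress_const_eq_zero _ hD]
  rfl

theorem collWeight_const (v : EuclideanSpace ℂ (QReg X Y k d)) :
    collWeight (fun _ : X → Y => v) = 0 := by
  refine sum_eq_zero fun D hD => ?_
  obtain ⟨x, x', -, -, h⟩ := (mem_filter.1 hD).2
  rw [vecCompress_const_eq_zero v ⟨x', mem_pdom.2 h⟩]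
  simp

theorem sizeLE_const (v : EuclideanSpace ℂ (QReg X Y k d)) :
    SizeLE (fun _ : X → Y => v) 0 := fun _ hD =>
  vecCompress_const_eq_zero v (card_pos.1 hD)

/-- The state after `q` rounds of queries and unitaries. -/
noncomputable def runState {q : ℕ}
    (U : Fin q → (EuclideanSpace ℂ (QReg X Y k d) ≃ₗᵢ[ℂ] EuclideanSpace ℂ (QReg X Y k d)))
    (v : EuclideanSpace ℂ (QReg X Y k d)) (H : X → Y) : EuclideanSpace ℂ (QReg X Y k d) :=
  Fin.foldl q (fun ψ s => U s (parallelQuery H ψ)) v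

theorem runState_zero
    (U : Fin 0 → (EuclideanSpace ℂ (QReg X Y k d) ≃ₗᵢ[ℂ] EuclideanSpace ℂ (QReg X Y k d)))
    (v : EuclideanSpace ℂ (QReg X Y k d)) : runState U v = fun _ : X → Y => v :=
  funext fun _ => Fin.foldl_zero _ _

theorem runState_succ {q : ℕ}
    (U : Fin (q + 1) → (EuclideanSpace ℂ (QReg X Y k d) ≃ₗᵢ[ℂ] EuclideanSpace ℂ (QReg X Y k d)))
    (v : EuclideanSpace ℂ (QReg X Y k d)) (H : X → Y) :
    runState U v H
      = U (Fin.last q) (parallelQuery H (runState (fun s => U s.castSucc) v H)) :=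
  Fin.foldl_succ_last _ _

theorem norm_runState {q : ℕ}
    (U : Fin q → (EuclideanSpace ℂ (QReg X Y k d) ≃ₗᵢ[ℂ] EuclideanSpace ℂ (QReg X Y k d)))
    (v : EuclideanSpace ℂ (QReg X Y k d)) (H : X → Y) : ‖runState U v H‖ = ‖v‖ := by
  induction q with
  | zero => simp [runState]
  | succ q ih => rw [runState_succ, LinearIsometryEquiv.norm_map, LinearIsometryEquiv.norm_map, ih]

theorem sizeLE_runState {q : ℕ}
    (U : Fin q → (EuclideanSpace ℂ (QReg X Y k d) ≃ₗᵢ[ℂ] EuclideanSpace ℂ (QReg X Y k d)))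
    (v : EuclideanSpace ℂ (QReg X Y k d)) : SizeLE (runState U v) (k * q) := by
  induction q with
  | zero => simpa [runState_zero] using sizeLE_const v
  | succ q ih =>
    rw [funext (runState_succ U v), Nat.mul_succ]
    exact (ih _).parallelQuery.map _

theorem sqrt_collWeight_runState_le {q : ℕ}
    (U : Fin q → (EuclideanSpace ℂ (QReg X Y k d) ≃ₗᵢ[ℂ] EuclideanSpace ℂ (QReg X Y k d)))
    {v : EuclideanSpace ℂ (QReg X Y k d)} (hv : ‖v‖ = 1) :
    √(collWeight (runState U v))
      ≤ q * (√(8 / Fintype.card Y * (k * (4 * k + k * q))) * √(Fintype.card (X → Y))) := by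
  induction q with
  | zero => simp [runState_zero, collWeight_const]
  | succ q ih =>
    rw [funext (runState_succ U v), collWeight_map]
    refine (sqrt_collWeight_parallelQuery_le (sizeLE_runState _ v)).trans ?_
    have hN : ∑ H : X → Y, ‖runState (fun s : Fin q => U s.castSucc) v H‖ ^ 2
        = Fintype.card (X → Y) := by
      simp [norm_runState, hv]
    rw [hN, Nat.cast_mul]
    refine (add_le_add_left (ih _) _).trans ?_
    have hmono : √(8 / Fintype.card Y * (k * (4 * k + k * q)))
        ≤ √(8 / Fintype.card Y * (k * (4 * k + k * (q + 1 : ℕ)))) := by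
      push_cast
      gcongr
      linarith
    calc _ = ((q + 1 : ℕ) : ℝ) * (√(8 / Fintype.card Y * (k * (4 * k + k * q)))
          * √(Fintype.card (X → Y))) := by push_cast; ring
      _ ≤ _ := by gcongr

/-- The probability of outputting a collision, in terms of the progress measure. -/
theorem sqrt_collisionProb_le {q : ℕ} (A : ParallelQueryAlg X Y k q) :
    √A.collisionProb
      ≤ q * √(8 / Fintype.card Y * (k * (4 * k + k * q))) + √(4 * (2 / Fintype.card Y)) := by
  have : Nonempty Y := ⟨0⟩
  have hN : (0 : ℝ) < Fintype.card (X → Y) := by exact_mod_cast Fintype.card_pos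
  set Ψ := runState A.unitary A.init with hΨ
  have hsum : ∑ H, A.collisionProbFor H
      = ∑ r : QReg X Y k A.dim, ∑ H with IsCollision H (A.output r), ‖Ψ H r‖ ^ 2 := by
    simp only [ParallelQueryAlg.collisionProbFor, sum_filter]
    exact sum_comm
  have hnorm : ∑ r : QReg X Y k A.dim, ∑ H, ‖Ψ H r‖ ^ 2 = Fintype.card (X → Y) := by
    rw [sum_comm]
    simp only [← EuclideanSpace.norm_sq_eq]
    simp [hΨ, norm_runState, A.norm_init]
  have key : √(∑ H, A.collisionProbFor H)
      ≤ √(collWeight Ψ) + √(4 * (2 / Fintype.card Y)) * √(Fintype.card (X → Y)) := by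
    rw [hsum, collWeight_eq_sum, ← hnorm]
    refine sqrt_sum_le_of_sqrt_le _ (Real.sqrt_nonneg _)
      (fun _ => sum_nonneg fun _ _ => by positivity) (fun _ => sum_nonneg fun _ _ => by positivity)
      (fun _ => sum_nonneg fun _ _ => by positivity) fun r _ => ?_
    by_cases h : (A.output r).1 = (A.output r).2
    · simp only [IsCollision, h, ne_eq, not_true_eq_false, false_and, filter_false, sum_empty,
        Real.sqrt_zero]
      positivity
    · simp only [IsCollision, ne_eq, h, not_false_eq_true, true_and]
      exact sqrt_collision_le h _
  rw [ParallelQueryAlg.collisionProb, Real.sqrt_div' _ hN.le, div_le_iff₀ (Real.sqrt_pos.2 hN)]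
  refine key.trans ((add_le_add_left (sqrt_collWeight_runState_le A.unitary A.norm_init) _).trans
    (le_of_eq ?_))
  ring

end Progress

/-! ### The explicit bounds -/

theorem collisionProb_le_collisionBound {X Y : Type*} [Fintype X] [Fintype Y] [DecidableEq X]
    [DecidableEq Y] [AddCommGroup Y] {k q : ℕ} (hk : 1 ≤ k) (A : ParallelQueryAlg X Y k q) :
    A.collisionProb ≤ collisionBound k q (Fintype.card Y) := by
  have hk' : (1 : ℝ) ≤ k := by exact_mod_cast hk
  have hq : (0 : ℝ) ≤ q := Nat.cast_nonneg q
  have hp : 0 ≤ A.collisionProb := by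
    refine div_nonneg (sum_nonneg fun H _ => sum_nonneg fun r _ => ?_) (Nat.cast_nonneg _)
    split_ifs <;> positivity
  rw [← Real.sq_sqrt hp, collisionBound]
  refine pow_le_pow_left₀ (Real.sqrt_nonneg _) ((sqrt_collisionProb_le A).trans ?_) 2
  set M : ℝ := (Fintype.card Y : ℝ)
  have hM : 0 ≤ M := Nat.cast_nonneg _
  set R := √(10 * (((q : ℝ) + 1) / M)) with hR
  have hR0 : 0 ≤ R := Real.sqrt_nonneg _
  -- Each round costs at most `2 k R`, and the excess `√(2 / M)` of the final step is paid for by the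
  -- factor `q + 1` in place of `q`.
  have h1 : √(8 / M * (k * (4 * k + k * q))) ≤ k * (2 * R) := by
    refine Real.sqrt_le_iff.2 ⟨by positivity, ?_⟩
    rw [mul_pow, mul_pow, hR, Real.sq_sqrt (by positivity)]
    calc 8 / M * (k * (4 * k + k * q)) = k ^ 2 * ((8 * q + 32) / M) := by ring
      _ ≤ k ^ 2 * ((40 * q + 40) / M) := by gcongr <;> linarith
      _ = k ^ 2 * (2 ^ 2 * (10 * ((q + 1) / M))) := by ring
  have h2 : √(4 * (2 / M)) = 2 * √(2 / M) := by
    rw [Real.sqrt_mul (by norm_num), show (4 : ℝ) = 2 ^ 2 by norm_num,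
      Real.sqrt_sq (by norm_num)]
  have h3 : √(2 / M) ≤ R := by
    refine Real.sqrt_le_sqrt ?_
    calc 2 / M ≤ (10 * (q + 1)) / M := by gcongr; linarith
      _ = 10 * ((q + 1) / M) := by ring
  have h4 : (q : ℝ) * √(8 / M * (k * (4 * k + k * q))) ≤ q * (k * (2 * R)) := by gcongr
  have h5 : R ≤ k * (2 * R) := by nlinarith
  have h6 : ((q : ℝ) + 1) * (k * (2 * R)) * 1 ≤ (q + 1) * (k * (2 * R)) * Real.exp 1 := by
    gcongr
    exact Real.one_le_exp zero_le_one
  rw [h2]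
  nlinarith

theorem exists_collisionBound_le : ∃ C : ℝ, 0 < C ∧ ∀ k q M : ℕ, 1 ≤ k → 1 ≤ q → 1 ≤ M →
    collisionBound k q M ≤ C * ((k : ℝ) ^ 2 * (q : ℝ) ^ 3 / (M : ℝ)) := by
  -- With `q + 1 ≤ 2 q`, both summands of the bound are multiples of `k q √(q / M)`.
  refine ⟨(4 * Real.exp 1 * √20 + √2) ^ 2, by positivity, fun k q M hk hq hM => ?_⟩
  have hk' : (1 : ℝ) ≤ k := by exact_mod_cast hk
  have hq' : (1 : ℝ) ≤ q := by exact_mod_cast hq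
  set s := √((q : ℝ) / M) with hs
  have h1 : √(10 * (((q : ℝ) + 1) / M)) ≤ √20 * s := by
    rw [hs, ← Real.sqrt_mul (by norm_num)]
    refine Real.sqrt_le_sqrt ?_
    calc 10 * (((q : ℝ) + 1) / M) ≤ 10 * ((q + q) / M) := by gcongr
      _ = 20 * (q / M) := by ring
  have h2 : √(2 / (M : ℝ)) ≤ √2 * (k * q * s) := by
    rw [div_eq_mul_inv, Real.sqrt_mul (by norm_num)]
    gcongr
    calc √((M : ℝ)⁻¹) ≤ s := Real.sqrt_le_sqrt (by
          rw [← one_div]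
          gcongr)
      _ ≤ (k * q) * s := le_mul_of_one_le_left (Real.sqrt_nonneg _)
          (one_le_mul_of_one_le_of_one_le hk' hq')
  calc collisionBound k q M
      ≤ (2 * ((q : ℝ) + q) * Real.exp 1 * k * (√20 * s) + √2 * (k * q * s)) ^ 2 := by
        rw [collisionBound]
        gcongr
    _ = (4 * Real.exp 1 * √20 + √2) ^ 2 * (k ^ 2 * q ^ 2 * s ^ 2) := by ring
    _ = (4 * Real.exp 1 * √20 + √2) ^ 2 * ((k : ℝ) ^ 2 * (q : ℝ) ^ 3 / M) := by
        rw [hs, Real.sq_sqrt (by positivity)]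
        ring

theorem mainTheorem7 :
    (∀ (X Y : Type*) [Fintype X] [Fintype Y] [DecidableEq X] [DecidableEq Y] [AddCommGroup Y]
        (k q : ℕ), 1 ≤ k → ∀ A : ParallelQueryAlg X Y k q,
        A.collisionProb ≤ collisionBound k q (Fintype.card Y)) ∧
    (∃ C : ℝ, 0 < C ∧ ∀ k q M : ℕ, 1 ≤ k → 1 ≤ q → 1 ≤ M →
        collisionBound k q M ≤ C * ((k : ℝ) ^ 2 * (q : ℝ) ^ 3 / (M : ℝ))) ∧
    (∀ δ : ℝ, 0 < δ → ∃ c : ℝ, 0 < c ∧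
      ∀ (X Y : Type*) [Fintype X] [Fintype Y] [DecidableEq X] [DecidableEq Y] [AddCommGroup Y]
        (k q : ℕ), 1 ≤ k → 1 ≤ q → ∀ A : ParallelQueryAlg X Y k q,
        δ ≤ A.collisionProb →
        c * ((Fintype.card Y : ℝ) / (k : ℝ) ^ 2) ^ ((1 : ℝ) / 3) ≤ (q : ℝ)) := by
  refine ⟨fun X Y _ _ _ _ _ k q hk A => collisionProb_le_collisionBound hk A,
    exists_collisionBound_le, fun δ hδ => ?_⟩
  obtain ⟨C, hC, hbound⟩ := exists_collisionBound_le
  refine ⟨(δ / C) ^ ((1 : ℝ) / 3), by positivity, fun X Y _ _ _ _ _ k q hk hq A hA => ?_⟩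
  have : Nonempty Y := ⟨0⟩
  have hM : (0 : ℝ) < Fintype.card Y := by exact_mod_cast Fintype.card_pos
  have hk' : (0 : ℝ) < k := by exact_mod_cast hk
  have h : δ ≤ C * ((k : ℝ) ^ 2 * (q : ℝ) ^ 3 / Fintype.card Y) :=
    hA.trans ((collisionProb_le_collisionBound hk A).trans
      (hbound k q _ hk hq Fintype.card_pos))
  have h' : δ / C * (Fintype.card Y / (k : ℝ) ^ 2) ≤ (q : ℝ) ^ 3 := by
    rw [div_mul_div_comm, div_le_iff₀ (by positivity)]
    rw [← mul_div_assoc, le_div_iff₀ hM] at h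
    linarith
  rw [← Real.mul_rpow (by positivity) (by positivity)]
  calc (δ / C * (Fintype.card Y / (k : ℝ) ^ 2)) ^ ((1 : ℝ) / 3)
      ≤ ((q : ℝ) ^ 3) ^ ((1 : ℝ) / 3) := by gcongr
    _ = (q : ℝ) := by
        rw [← Real.rpow_natCast, ← Real.rpow_mul (Nat.cast_nonneg q)]
        norm_num
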